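/- Let $d\ge 1$, let $\mathcal Z\subset\mathbb R^d$ be compact and convex, and let $\widetilde{\mathcal Z}\supseteq\mathcal Z$ be a closed ball of positive radius centred at the origin. Let $f:\widetilde{\mathcal Z}\times\widetilde{\mathcal Z}\to\mathbb R$ be symmetric, continuous and nonnegative-definite, with a Mercer expansion $f(x,y)=\sum_{k\ge1}\lambda_k u_k(x)u_k(y)$ for $x,y\in\widetilde{\mathcal Z}$, converging absolutely and uniformly, where $\lambda_k\ge0$ and the $u_k$ are orthonormal in $L^2(\widetilde{\mathcal Z})$ with respect to Lebesgue measure. For $x\in\mathcal Z$ put $\phi(x)=(\lambda_k^{1/2}u_k(x))_{k\ge1}\in\ell_2$, and let $\mathcal M=\phi(\mathcal Z)$. Assume that for all $x\ne y$ in $\mathcal Z$ there is $a\in\mathcal Z$ with $f(x,a)\ne f(y,a)$. For a subset $S$ of $\ell_2$ or of $\mathbb R^d$ and $a,b\in S$, let $D_S(a,b)\in[0,\infty]$ be the infimum of the lengths of the continuous paths in $S$ from $a$ to $b$, where the length of $\gamma:[0,1]\to S$ is the supremum of $\sum_k\|\gamma_{t_k}-\gamma_{t_{k-1}}\|$ over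 all partitions $0=t_0\le\dots\le t_n=1$. Suppose that $f(x,y)=g(x-y)$ for all $x,y\in\widetilde{\mathcal Z}$, where $g:\mathbb R^d\to\mathbb R$ is $C^2$ and has a local maximum at the origin. Let $H$ be the Hessian matrix of $-g$ at the origin. (i) If $H=V\Lambda V^\top$ is an eigendecomposition of $H$ ($V$ orthogonal, $\Lambda$ diagonal), then $G=V\Lambda^{1/2}$ satisfies $GG^\top=H$; and for this $G$, and for every other $G\in\mathbb R^{d\times d}$ with $GG^\top=H$, $$D_{\mathcal M}(\phi(x),\phi(y))=\|G^\top(x-y)\|\qquad\text{for all }x,y\in\mathcal Z.$$ (ii) If moreover $g(x-y)=h(\|x-y\|^2)$ for all $x,y\in\widetilde{\mathcal Z}$, where $h$ has a (one-sided) derivative at $0$ with $h'(0)<0$, then there is a constant $c>0$ such that $$D_{\mathcal M}(\phi(x),\phi(y))=c\,D_{\mathcal Z}(x,y)\quad\text{and}\quad D_{\mathcal Z}(x,y)=\|x-y\|\qquad\text{for all }x,y\in\mathcal Z.$$ -/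

import Mathlib

open MeasureTheory Filter Topology
open scoped ENNReal

/-- The length of a path, as the supremum over all partitions of `[0,1]` of the sum of the
distances between consecutive points; it may be infinite. -/
noncomputable def pathLength {X : Type*} [PseudoEMetricSpace X] {a b : X} (γ : Path a b) : ℝ≥0∞ :=
  eVariationOn γ Set.univ

/-- The geodesic distance in `S` between `a` and `b`: the infimum of the lengths of the continuous
paths from `a` to `b` which stay in `S` (it is `∞` if no such path has finite length). -/
noncomputable def geodesicDist {X : Type*} [PseudoEMetricSpace X] (S : Set X) (a b : X) : ℝ≥0∞ :=
  ⨅ (γ : Path a b) (_ : ∀ t, γ t ∈ S), pathLength γ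

/-- `f` is a symmetric, continuous, nonnegative-definite function on `S × S`. -/
structure IsNonnegDefKernelOn {X : Type*} [TopologicalSpace X] (S : Set X) (f : X → X → ℝ) :
    Prop where
  symm : ∀ x ∈ S, ∀ y ∈ S, f x y = f y x
  continuousOn : ContinuousOn (fun p : X × X => f p.1 p.2) (S ×ˢ S)
  nonneg : ∀ (n : ℕ) (x : Fin n → X) (c : Fin n → ℝ), (∀ i, x i ∈ S) →
    0 ≤ ∑ i, ∑ j, c i * c j * f (x i) (x j)

/-- A Mercer expansion of `f` on `S`: nonnegative `lam k` and functions `u k` which are orthonormal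
in `L²(S)` (Lebesgue measure), with `f x y = ∑ₖ lam k * u k x * u k y` for `x, y ∈ S`, where the
convergence is absolute and uniform. -/
structure IsMercerExpansion {X : Type*} [MeasureSpace X] (S : Set X) (f : X → X → ℝ)
    (lam : ℕ → ℝ) (u : ℕ → X → ℝ) : Prop where
  nonneg : ∀ k, 0 ≤ lam k
  memLp : ∀ k, MemLp (u k) 2 (volume.restrict S)
  orthonormal : ∀ j k, ∫ x in S, u j x * u k x = if j = k then 1 else 0
  summable : ∀ x ∈ S, ∀ y ∈ S, Summable fun k => |lam k * u k x * u k y|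
  tendstoUniformlyOn : TendstoUniformlyOn
    (fun (n : ℕ) (p : X × X) => ∑ k ∈ Finset.range n, lam k * u k p.1 * u k p.2)
    (fun p => f p.1 p.2) atTop (S ×ˢ S)

theorem IsMercerExpansion.memℓp {X : Type*} [MeasureSpace X] {S : Set X} {f : X → X → ℝ}
    {lam : ℕ → ℝ} {u : ℕ → X → ℝ} (h : IsMercerExpansion S f lam u) (x : S) :
    Memℓp (fun k => Real.sqrt (lam k) * u k x) 2 := by
  refine memℓp_gen ?_
  refine (h.summable x x.2 x x.2).congr fun k => ?_
  have h0 := h.nonneg k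
  have e : lam k * u k x * u k x = (Real.sqrt (lam k) * u k x) ^ 2 := by
    rw [mul_pow, Real.sq_sqrt h0]; ring
  rw [e]
  simp

/-- The feature map `φ(x) = (lam₁^{1/2} u₁(x), lam₂^{1/2} u₂(x), …) ∈ ℓ₂`, for `x ∈ S`. -/
noncomputable def mercerMap {X : Type*} [MeasureSpace X] {S : Set X} {f : X → X → ℝ}
    {lam : ℕ → ℝ} {u : ℕ → X → ℝ} (h : IsMercerExpansion S f lam u) (x : S) :
    lp (fun _ : ℕ => ℝ) 2 :=
  ⟨fun k => Real.sqrt (lam k) * u k x, h.memℓp x⟩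

/-- The Hessian matrix of `g` at `x`. -/
noncomputable def hessianMatrix {d : ℕ} (g : EuclideanSpace ℝ (Fin d) → ℝ)
    (x : EuclideanSpace ℝ (Fin d)) : Matrix (Fin d) (Fin d) ℝ :=
  Matrix.of fun i j =>
    fderiv ℝ (fderiv ℝ g) x (EuclideanSpace.single i 1) (EuclideanSpace.single j 1)

/-! The kernel expansion gives `‖φ x - φ y‖ ^ 2 = 2 * (g 0 - g (x - y))`, and Taylor's formula at
the critical point `0` turns this into `‖L (x - y)‖ ^ 2` up to `o(‖x - y‖ ^ 2)`, with `L v = Gᵀ v`;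
in (ii), `L` is a multiple of the identity. So `φ` is an infinitesimal isometry for `‖L ·‖`.

Upper bound: cutting a segment finely gives `‖φ x - φ y‖ ≤ ‖L (x - y)‖` globally, so the image of
the segment has length at most `‖L (x - y)‖`. Lower bound: `φ` is injective since `f` separates
points, hence so is `L` on `Z`, and the error becomes small relative to `‖L ·‖ ^ 2`. By compactness
a path in the image lifts to `Z`; cutting it finely bounds its length below by `θ * ‖L (x - y)‖` for
every `θ < 1`. Both bounds are in `geodesicDist_range_eq`. -/

/-! ### Lengths of paths -/

open scoped unitInterval NNReal in
/-- If a curve `η` moves, on small scales, at most `K` times as much as the curve `γ`, then the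
distance between its endpoints is at most `K` times the length of `γ`. -/
theorem edist_le_mul_eVariationOn_of_local {A B : Type*} [PseudoEMetricSpace A]
    [PseudoEMetricSpace B] {η : I → A} {γ : I → B} {K : ℝ≥0∞} {δ : ℝ} (hδ : 0 < δ)
    (h : ∀ s t : I, dist s t < δ → edist (η s) (η t) ≤ K * edist (γ s) (γ t)) :
    edist (η 0) (η 1) ≤ K * eVariationOn γ Set.univ := by
  obtain ⟨n, hn⟩ := exists_nat_one_div_lt hδ
  set N : ℕ := n + 1 with hN
  have hNpos : (0 : ℝ) < N := by positivity
  -- Equal subdivision of mesh `1 / N < δ`; the projection keeps `ν` monotone on all of `ℕ`,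
  -- constant past `N`.
  let ν : ℕ → I := fun i => Set.projIcc 0 1 zero_le_one ((i : ℝ) / N)
  have hmono : Monotone ν := fun i j hij => Set.monotone_projIcc _ (by gcongr)
  have h0 : ν 0 = 0 := by simp [ν, Set.projIcc_left]
  have h1 : ν N = 1 := by
    simp only [ν]; rw [div_self hNpos.ne']; exact Set.projIcc_right _
  have hd : ∀ i, dist (ν (i + 1)) (ν i) < δ := fun i => by
    have hle : dist (ν (i + 1)) (ν i) ≤ dist (((i + 1 : ℕ) : ℝ) / N) ((i : ℝ) / N) := by
      rw [Subtype.dist_eq, Real.dist_eq, Real.dist_eq]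
      exact Set.abs_projIcc_sub_projIcc _
    refine hle.trans_lt ?_
    rw [Real.dist_eq, ← sub_div, Nat.cast_succ, add_sub_cancel_left, abs_of_pos (by positivity)]
    simpa [hN] using hn
  calc edist (η 0) (η 1) = edist (η (ν 0)) (η (ν N)) := by rw [h0, h1]
    _ ≤ ∑ i ∈ Finset.range N, edist (η (ν i)) (η (ν (i + 1))) :=
        edist_le_range_sum_edist (fun i => η (ν i)) N
    _ ≤ ∑ i ∈ Finset.range N, K * edist (γ (ν (i + 1))) (γ (ν i)) := by
        refine Finset.sum_le_sum fun i _ => ?_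
        rw [edist_comm]
        exact h _ _ (hd i)
    _ ≤ K * eVariationOn γ Set.univ := by
        rw [← Finset.mul_sum]
        gcongr
        exact eVariationOn.sum_le hmono fun _ => Set.mem_univ _

open scoped unitInterval in
theorem eVariationOn_unitInterval_id_le :
    eVariationOn (id : I → I) Set.univ ≤ 1 := by
  have h := (show MonotoneOn (fun t : I => (t : ℝ)) Set.univ from
    fun _ _ _ _ h => h).eVariationOn_eq (a := 0) (b := 1) (Set.mem_univ _) (Set.mem_univ _)
  have e : (Set.univ ∩ Set.Icc (0 : I) 1) = Set.univ :=
    Set.eq_univ_of_forall fun t => ⟨Set.mem_univ _, t.2.1, t.2.2⟩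
  rw [e, Set.Icc.coe_one, Set.Icc.coe_zero, sub_zero, ENNReal.ofReal_one] at h
  exact h.le

open scoped NNReal in
theorem pathLength_le_of_lipschitz {X : Type*} [PseudoEMetricSpace X] {a b : X} {γ : Path a b}
    {C : ℝ≥0} (h : LipschitzWith C γ) : pathLength γ ≤ C := by
  have h1 := (h.lipschitzOnWith (s := Set.univ)).comp_eVariationOn_le (g := id) (s := Set.univ)
    (Set.mapsTo_univ _ _)
  calc pathLength γ ≤ C * eVariationOn (id : unitInterval → unitInterval) Set.univ := h1
    _ ≤ C * 1 := by gcongr; exact eVariationOn_unitInterval_id_le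
    _ = C := mul_one _

theorem edist_le_geodesicDist {X : Type*} [PseudoEMetricSpace X] (S : Set X) (a b : X) :
    edist a b ≤ geodesicDist S a b := by
  refine le_iInf₂ fun γ _ => ?_
  have h := eVariationOn.edist_le γ (Set.mem_univ (0 : unitInterval)) (Set.mem_univ 1)
  rwa [γ.source, γ.target] at h

/-! ### Segments and linear maps on convex sets -/

/-- The segment from `x` to `y`, as a path in a convex set. -/
noncomputable def Convex.segmentPath {E : Type*} [NormedAddCommGroup E] [NormedSpace ℝ E]
    {Z : Set E} (hZ : Convex ℝ Z) (x y : Z) : Path x y where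
  toFun t := ⟨AffineMap.lineMap (x : E) y (t : ℝ), hZ.lineMap_mem x.2 y.2 t.2⟩
  continuous_toFun := by
    refine Continuous.subtype_mk ?_ _
    exact AffineMap.lineMap_continuous.comp continuous_subtype_val
  source' := by simp
  target' := by simp

theorem Convex.segmentPath_sub {E : Type*} [NormedAddCommGroup E] [NormedSpace ℝ E]
    {Z : Set E} (hZ : Convex ℝ Z) (x y : Z) (s t : unitInterval) :
    (hZ.segmentPath x y s : E) - hZ.segmentPath x y t = ((t : ℝ) - s) • ((x : E) - y) := by
  change AffineMap.lineMap (x : E) (y : E) (s : ℝ) - AffineMap.lineMap (x : E) (y : E) (t : ℝ) = _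
  simp only [AffineMap.lineMap_apply_module']
  module

theorem geodesicDist_of_convex {E : Type*} [NormedAddCommGroup E] [NormedSpace ℝ E] {Z : Set E}
    (hZ : Convex ℝ Z) {x y : E} (hx : x ∈ Z) (hy : y ∈ Z) :
    geodesicDist Z x y = ENNReal.ofReal ‖x - y‖ := by
  rw [← dist_eq_norm, ← edist_dist]
  refine le_antisymm ?_ (edist_le_geodesicDist Z x y)
  let γ : Path x y := (hZ.segmentPath ⟨x, hx⟩ ⟨y, hy⟩).map continuous_subtype_val
  refine (iInf₂_le γ fun t => (hZ.segmentPath ⟨x, hx⟩ ⟨y, hy⟩ t).2).trans ?_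
  rw [edist_nndist]
  refine pathLength_le_of_lipschitz (LipschitzWith.of_dist_le_mul fun s t => ?_)
  have : γ s - γ t = ((t : ℝ) - s) • (x - y) := hZ.segmentPath_sub ⟨x, hx⟩ ⟨y, hy⟩ s t
  rw [dist_eq_norm, this, norm_smul, coe_nndist, dist_eq_norm, mul_comm, Real.norm_eq_abs,
    Subtype.dist_eq, Real.dist_eq, abs_sub_comm]

/-- The cone over `Z - Z` is symmetric, and convexity makes it closed under addition: a sum is
rescaled to a difference of weighted means. So it is already a subspace. -/
theorem Convex.exists_eq_smul_sub_of_mem_span {E : Type*} [AddCommGroup E] [Module ℝ E]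
    {Z : Set E} (hZ : Convex ℝ Z) (hne : Z.Nonempty) {v : E}
    (hv : v ∈ Submodule.span ℝ {w | ∃ x ∈ Z, ∃ y ∈ Z, w = x - y}) :
    ∃ t : ℝ, 0 ≤ t ∧ ∃ x ∈ Z, ∃ y ∈ Z, v = t • (x - y) := by
  obtain ⟨z, hz⟩ := hne
  induction hv using Submodule.span_induction with
  | mem v hv =>
    obtain ⟨x, hx, y, hy, rfl⟩ := hv
    exact ⟨1, zero_le_one, x, hx, y, hy, (one_smul _ _).symm⟩
  | zero => exact ⟨0, le_rfl, z, hz, z, hz, by simp⟩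
  | add v w _ _ hv hw =>
    obtain ⟨s, hs, x, hx, y, hy, rfl⟩ := hv
    obtain ⟨t, ht, x', hx', y', hy', rfl⟩ := hw
    rcases (add_nonneg hs ht).eq_or_lt with h0 | hpos
    · exact ⟨0, le_rfl, z, hz, z, hz, by
        rw [show s = 0 by linarith, show t = 0 by linarith]; simp⟩
    · have h1 : s / (s + t) + t / (s + t) = 1 := by field_simp
      refine ⟨s + t, hpos.le, _, hZ hx hx' (by positivity) (by positivity) h1, _,
        hZ hy hy' (by positivity) (by positivity) h1, ?_⟩
      have e1 : (s + t) * (s / (s + t)) = s := by field_simp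
      have e2 : (s + t) * (t / (s + t)) = t := by field_simp
      simp only [smul_sub, smul_add, smul_smul, e1, e2]
      abel
  | smul a v _ hv =>
    obtain ⟨s, hs, x, hx, y, hy, rfl⟩ := hv
    rcases le_total 0 a with ha | ha
    · exact ⟨a * s, mul_nonneg ha hs, x, hx, y, hy, by rw [smul_smul]⟩
    · exact ⟨-a * s, mul_nonneg (neg_nonneg.2 ha) hs, y, hy, x, hx, by module⟩

/-- `L` may have a kernel on `E` when `Z` is lower-dimensional, but it is injective on the span of
`Z - Z`, hence bounded below there by finite dimensionality. -/
theorem Convex.exists_le_norm_map_sub {E F : Type*} [NormedAddCommGroup E] [NormedSpace ℝ E]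
    [FiniteDimensional ℝ E] [NormedAddCommGroup F] [NormedSpace ℝ F] {Z : Set E}
    (hZ : Convex ℝ Z) (L : E →ₗ[ℝ] F) (hL : Set.InjOn L Z) :
    ∃ c : ℝ, 0 < c ∧ ∀ x ∈ Z, ∀ y ∈ Z, c * ‖x - y‖ ≤ ‖L (x - y)‖ := by
  rcases Z.eq_empty_or_nonempty with rfl | hne
  · exact ⟨1, one_pos, by simp⟩
  set W := Submodule.span ℝ {w | ∃ x ∈ Z, ∃ y ∈ Z, w = x - y} with hW
  have hker : LinearMap.ker (L.domRestrict W) = ⊥ := by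
    rw [LinearMap.ker_eq_bot']
    rintro ⟨v, hv⟩ h0
    obtain ⟨t, -, x, hx, y, hy, rfl⟩ := hZ.exists_eq_smul_sub_of_mem_span hne hv
    have h0' : t • (L x - L y) = 0 := by
      simpa only [LinearMap.domRestrict_apply, map_smul, map_sub] using h0
    rcases smul_eq_zero.1 h0' with rfl | h
    · simp
    · simp [hL hx hy (sub_eq_zero.1 h)]
  obtain ⟨K, hK, hanti⟩ := LinearMap.exists_antilipschitzWith _ hker
  have hK' : (0 : ℝ) < K := hK
  refine ⟨(K : ℝ)⁻¹, by positivity, fun x hx y hy => ?_⟩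
  have hmem : x - y ∈ W := Submodule.subset_span ⟨x, hx, y, hy, rfl⟩
  have := hanti.le_mul_dist ⟨x - y, hmem⟩ 0
  rw [map_zero, dist_zero_right, dist_zero_right] at this
  rw [inv_mul_le_iff₀ hK']
  simpa using this

/-! ### Geodesics under an infinitesimal isometry -/

section SquaredDistance

variable {E F M : Type*} [NormedAddCommGroup E] [NormedSpace ℝ E] [NormedAddCommGroup F]
  [NormedSpace ℝ F] [MetricSpace M] {Z : Set E} {φ : Z → M} {k : E → ℝ} {L : E →L[ℝ] F}

/-- A map whose squared distances are a function `k` of the difference of the points, where `k v`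
is to second order `‖L v‖ ^ 2`, does not increase distances with respect to `‖L ·‖`. -/
theorem dist_le_norm_map_sub_of_isLittleO (hZ : Convex ℝ Z)
    (hφ : ∀ x y : Z, dist (φ x) (φ y) ^ 2 = k (x - y))
    (hk : (fun v => k v - ‖L v‖ ^ 2) =o[𝓝 0] fun v => ‖v‖ ^ 2) (x y : Z) :
    dist (φ x) (φ y) ≤ ‖L (x - y)‖ := by
  refine le_of_forall_gt fun C hC => ?_
  obtain ⟨D, hD, hDC⟩ := exists_between hC
  refine lt_of_le_of_lt ?_ hDC
  have hD0 : 0 ≤ D := (norm_nonneg _).trans hD.le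
  set w : E := x - y with hw
  have hpos : 0 < D ^ 2 - ‖L w‖ ^ 2 := by
    have := norm_nonneg (L w); nlinarith
  -- The Taylor error on an increment `r • w` is at most `r ^ 2 * (ε * ‖w‖ ^ 2)`, which fits in the
  -- slack between `D` and `‖L w‖`; the `+ 1` covers `w = 0`.
  set ε := (D ^ 2 - ‖L w‖ ^ 2) / (‖w‖ ^ 2 + 1) with hε
  have hε0 : 0 < ε := by positivity
  obtain ⟨δ, hδ, hball⟩ := Metric.eventually_nhds_iff.1 (hk.def hε0)
  have hεw : ε * ‖w‖ ^ 2 ≤ D ^ 2 - ‖L w‖ ^ 2 := by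
    rw [hε, div_mul_eq_mul_div, div_le_iff₀ (by positivity)]
    nlinarith
  have key := edist_le_mul_eVariationOn_of_local (η := fun t => φ (hZ.segmentPath x y t))
    (γ := (id : unitInterval → unitInterval)) (K := ENNReal.ofReal D) (δ := δ / (‖w‖ + 1))
    (by positivity) fun s t hst => by
      rw [edist_dist, edist_dist, ← ENNReal.ofReal_mul hD0]
      refine ENNReal.ofReal_le_ofReal ?_
      rw [id, id, Subtype.dist_eq, Real.dist_eq, abs_sub_comm]
      rw [Subtype.dist_eq, Real.dist_eq, abs_sub_comm, lt_div_iff₀ (by positivity)] at hst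
      set r : ℝ := (t : ℝ) - s with hr
      refine abs_le_of_sq_le_sq' ?_ (by positivity) |>.2
      rw [hφ, hZ.segmentPath_sub, mul_pow, sq_abs]
      have hb := hball (y := r • w) (by
        rw [dist_zero_right, norm_smul, Real.norm_eq_abs]
        nlinarith [abs_nonneg r])
      rw [map_smul, norm_smul, norm_smul, mul_pow, mul_pow, Real.norm_eq_abs, Real.norm_eq_abs,
        Real.norm_eq_abs, sq_abs, abs_of_nonneg (a := r ^ 2 * ‖w‖ ^ 2) (by positivity)] at hb
      have := (abs_le.1 hb).2
      nlinarith [mul_le_mul_of_nonneg_left hεw (sq_nonneg r)]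
  have h2 : edist (φ x) (φ y) ≤ ENNReal.ofReal D := by
    calc edist (φ x) (φ y) ≤ ENNReal.ofReal D * eVariationOn id Set.univ := by
          simpa only [Path.source, Path.target] using key
      _ ≤ ENNReal.ofReal D * 1 := by gcongr; exact eVariationOn_unitInterval_id_le
      _ = ENNReal.ofReal D := mul_one _
  rw [edist_dist] at h2
  exact (ENNReal.ofReal_le_ofReal_iff hD0).1 h2

theorem eventually_mul_norm_map_sub_le_dist [FiniteDimensional ℝ E] (hZ : Convex ℝ Z)
    (hL : Set.InjOn L Z) (hφ : ∀ x y : Z, dist (φ x) (φ y) ^ 2 = k (x - y))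
    (hk : (fun v => k v - ‖L v‖ ^ 2) =o[𝓝 0] fun v => ‖v‖ ^ 2) {θ : ℝ} (hθ0 : 0 < θ)
    (hθ : θ < 1) :
    ∃ δ > 0, ∀ x y : Z, dist x y < δ → θ * ‖L (x - y)‖ ≤ dist (φ x) (φ y) := by
  obtain ⟨c, hc, hcL⟩ := hZ.exists_le_norm_map_sub (L : E →ₗ[ℝ] F) hL
  -- With this `ε` the error `ε * ‖v‖ ^ 2` is at most `(1 - θ ^ 2) * ‖L v‖ ^ 2`.
  have hε : 0 < (1 - θ ^ 2) * c ^ 2 := by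
    have : 0 < 1 - θ ^ 2 := by nlinarith
    positivity
  obtain ⟨δ, hδ, hball⟩ := Metric.eventually_nhds_iff.1 (hk.def hε)
  refine ⟨δ, hδ, fun x y hxy => ?_⟩
  have hb := hball (y := (x : E) - y) (by rwa [dist_zero_right, ← dist_eq_norm])
  rw [Real.norm_eq_abs, norm_pow, norm_norm] at hb
  have h1 := (abs_le.1 hb).1
  have h2 : c * ‖(x : E) - y‖ ≤ ‖L (x - y)‖ := hcL x x.2 y y.2
  refine abs_le_of_sq_le_sq' ?_ dist_nonneg |>.2
  rw [hφ, mul_pow]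
  have h3 : c ^ 2 * ‖(x : E) - y‖ ^ 2 ≤ ‖L (x - y)‖ ^ 2 := by
    rw [← mul_pow]; gcongr
  have h4 : 0 ≤ 1 - θ ^ 2 := by nlinarith
  nlinarith [mul_le_mul_of_nonneg_left h3 h4]

/-- Geodesic distances in the image of a compact convex set under an injective map `φ` whose
squared distances are a function of the difference of the points which is to second order
`‖L ·‖ ^ 2`. -/
theorem geodesicDist_range_eq [FiniteDimensional ℝ E] (hZc : IsCompact Z) (hZ : Convex ℝ Z)
    (hinj : Function.Injective φ) (hφ : ∀ x y : Z, dist (φ x) (φ y) ^ 2 = k (x - y))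
    (hk : (fun v => k v - ‖L v‖ ^ 2) =o[𝓝 0] fun v => ‖v‖ ^ 2) (x y : Z) :
    geodesicDist (Set.range φ) (φ x) (φ y) = ENNReal.ofReal ‖L (x - y)‖ := by
  have hup := dist_le_norm_map_sub_of_isLittleO hZ hφ hk
  have hL : Set.InjOn L Z := fun a ha b hb hab => by
    have := hup ⟨a, ha⟩ ⟨b, hb⟩
    rw [map_sub, hab, sub_self, norm_zero] at this
    exact congrArg Subtype.val (hinj (dist_le_zero.1 this))
  have hcont : Continuous φ := by
    refine (LipschitzWith.of_dist_le_mul (K := ‖L‖₊) fun a b => ?_).continuous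
    rw [Subtype.dist_eq, dist_eq_norm]
    exact (hup a b).trans (L.le_opNorm _)
  apply le_antisymm
  · let γ := (hZ.segmentPath x y).map hcont
    refine (iInf₂_le γ fun t => Set.mem_range_self _).trans ?_
    refine pathLength_le_of_lipschitz (LipschitzWith.of_dist_le_mul fun s t => ?_)
    refine (hup _ _).trans ?_
    rw [hZ.segmentPath_sub, map_smul, norm_smul, Real.coe_toNNReal _ (norm_nonneg _), mul_comm,
      Subtype.dist_eq, Real.dist_eq, abs_sub_comm, Real.norm_eq_abs]
  · refine le_iInf₂ fun γ hγ => ?_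
    have : CompactSpace Z := isCompact_iff_compactSpace.1 hZc
    -- The pointwise preimages are unique and form a continuous path, since a continuous injection
    -- of a compact space is a closed embedding.
    choose η hη using hγ
    have hηc : Continuous η := by
      rw [(hcont.isClosedEmbedding hinj).isInducing.continuous_iff]
      exact γ.continuous.congr fun t => (hη t).symm
    have hη0 : η 0 = x := hinj (by rw [hη, γ.source])
    have hη1 : η 1 = y := hinj (by rw [hη, γ.target])
    have huc := Metric.uniformContinuous_iff.1
      (CompactSpace.uniformContinuous_of_continuous hηc)
    have hlow : ∀ θ : ℝ, 0 < θ → θ < 1 →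
        ENNReal.ofReal (θ * ‖L (x - y)‖) ≤ pathLength γ := fun θ hθ0 hθ => by
      obtain ⟨ρ, hρ, hloc⟩ := eventually_mul_norm_map_sub_le_dist hZ hL hφ hk hθ0 hθ
      obtain ⟨δ, hδ, hd⟩ := huc ρ hρ
      have key := edist_le_mul_eVariationOn_of_local (η := fun t => θ • L (η t)) (γ := γ) (K := 1)
        hδ fun s t hst => by
          rw [one_mul, edist_dist, edist_dist]
          refine ENNReal.ofReal_le_ofReal ?_
          rw [dist_smul₀, Real.norm_of_nonneg hθ0.le, dist_eq_norm, ← map_sub, ← hη s, ← hη t]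
          exact hloc _ _ (hd hst)
      rwa [one_mul, edist_dist, dist_smul₀, Real.norm_of_nonneg hθ0.le, dist_eq_norm, ← map_sub,
        hη0, hη1] at key
    have hlim : Tendsto (fun θ : ℝ => ENNReal.ofReal (θ * ‖L (x - y)‖)) (𝓝[<] 1)
        (𝓝 (ENNReal.ofReal (1 * ‖L (x - y)‖))) := by
      refine ENNReal.tendsto_ofReal (Tendsto.mono_left ?_ nhdsWithin_le_nhds)
      exact tendsto_id.mul_const _
    rw [one_mul] at hlim
    refine le_of_tendsto hlim ?_
    filter_upwards [Ioo_mem_nhdsLT (zero_lt_one (α := ℝ))] with θ hθ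
    exact hlow θ hθ.1 hθ.2

end SquaredDistance

/-! ### The feature map and its kernel -/

theorem inner_mercerMap {X : Type*} [MeasureSpace X] {S : Set X} {f : X → X → ℝ} {lam : ℕ → ℝ}
    {u : ℕ → X → ℝ} (h : IsMercerExpansion S f lam u) (x y : S) :
    inner ℝ (mercerMap h x) (mercerMap h y) = f x y := by
  have h1 := lp.hasSum_inner (𝕜 := ℝ) (mercerMap h x) (mercerMap h y)
  have h2 := h.tendstoUniformlyOn.tendsto_at (x := ((x : X), (y : X))) ⟨x.2, y.2⟩
  refine tendsto_nhds_unique h1.tendsto_sum_nat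
    (h2.congr fun n => Finset.sum_congr rfl fun k _ => ?_)
  change _ = (Real.sqrt (lam k) * u k y) * (Real.sqrt (lam k) * u k x)
  rw [mul_mul_mul_comm, Real.mul_self_sqrt (h.nonneg k)]
  ring

theorem dist_mercerMap_sq {X : Type*} [MeasureSpace X] {S : Set X} {f : X → X → ℝ} {lam : ℕ → ℝ}
    {u : ℕ → X → ℝ} (h : IsMercerExpansion S f lam u) (x y : S) :
    dist (mercerMap h x) (mercerMap h y) ^ 2 = f x x - 2 * f x y + f y y := by
  rw [dist_eq_norm, norm_sub_sq_real, ← real_inner_self_eq_norm_sq, ← real_inner_self_eq_norm_sq]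
  simp only [inner_mercerMap]

/-! ### Second-order expansions and the Hessian -/

/-- Taylor's formula of order two at a critical point. -/
theorem ContDiff.sub_sub_fderiv_fderiv_isLittleO {E : Type*} [NormedAddCommGroup E]
    [NormedSpace ℝ E] {F : E → ℝ} (hF : ContDiff ℝ 2 F) (hcrit : fderiv ℝ F 0 = 0) :
    (fun v => 2 * (F v - F 0) - fderiv ℝ (fderiv ℝ F) 0 v v) =o[𝓝 0] fun v => ‖v‖ ^ 2 := by
  set B := fderiv ℝ (fderiv ℝ F) 0 with hB
  have hsymm : ∀ v w, B v w = B w v := fun v w =>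
    (hF.contDiffAt.isSymmSndFDerivAt (by simp)) v w
  have hF1 : Differentiable ℝ F := hF.differentiable (by norm_num)
  have hF2 : DifferentiableAt ℝ (fderiv ℝ F) 0 :=
    ((hF.fderiv_right (m := 1) (by norm_num)).differentiable (by norm_num)) 0
  have hlin : (fun v => fderiv ℝ F v - B v) =o[𝓝 0] fun v => v := by
    have := hF2.hasFDerivAt.isLittleO
    simpa [hcrit] using this
  -- By symmetry of `B` the remainder has derivative `2 • (fderiv ℝ F v - B v)`, which is `o(‖v‖)`;
  -- the mean value inequality on the ball of radius `‖v‖` gains one more order.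
  have hder : ∀ v, HasFDerivAt (fun v => 2 * (F v - F 0) - B v v)
      ((2 : ℝ) • (fderiv ℝ F v - B v)) v := fun v => by
    have h1 := ((hF1 v).hasFDerivAt.sub_const (F 0)).const_mul 2
    have h2 : HasFDerivAt (fun v => B v v) _ v := B.hasFDerivAt.clm_apply (hasFDerivAt_id v)
    refine (h1.sub h2).congr_fderiv ?_
    ext w
    simp [hsymm w v]
    ring
  rw [Asymptotics.isLittleO_iff]
  intro ε hε
  obtain ⟨δ, hδ, hball⟩ := Metric.eventually_nhds_iff_ball.1 (hlin.def (half_pos hε))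
  filter_upwards [Metric.ball_mem_nhds 0 hδ] with v hv
  have hsub : ∀ w ∈ Metric.closedBall (0 : E) ‖v‖, ‖(2 : ℝ) • (fderiv ℝ F w - B w)‖ ≤ ε * ‖v‖ := by
    intro w hw
    rw [mem_closedBall_zero_iff] at hw
    have := hball w (by rw [mem_ball_zero_iff] at hv ⊢; exact hw.trans_lt hv)
    rw [norm_smul, Real.norm_ofNat]
    nlinarith
  have := (convex_closedBall (0 : E) ‖v‖).norm_image_sub_le_of_norm_hasFDerivWithin_le
    (fun w _ => (hder w).hasFDerivWithinAt) hsub (x := 0) (y := v) (by simp) (by simp)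
  simpa [pow_two, mul_assoc] using this

theorem fderiv_fderiv_apply_eq_dotProduct {d : ℕ} (g : EuclideanSpace ℝ (Fin d) → ℝ)
    (x v w : EuclideanSpace ℝ (Fin d)) :
    fderiv ℝ (fderiv ℝ g) x v w = v.ofLp ⬝ᵥ (hessianMatrix g x).mulVec w.ofLp := by
  have e : ∀ z : EuclideanSpace ℝ (Fin d), z = ∑ i, z i • EuclideanSpace.single i (1 : ℝ) :=
    fun z => by
      ext j
      simp [Pi.single_apply]
  conv_lhs => rw [e v, e w]
  simp only [map_sum, map_smul, sum_apply, smul_apply,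
    dotProduct, Matrix.mulVec, hessianMatrix, Matrix.of_apply, smul_eq_mul, Finset.mul_sum]
  rw [Finset.sum_comm]
  refine Finset.sum_congr rfl fun i _ => Finset.sum_congr rfl fun j _ => ?_
  ring

/-- The second order condition at a local maximum. -/
theorem IsLocalMax.fderiv_fderiv_neg_nonneg {E : Type*} [NormedAddCommGroup E]
    [NormedSpace ℝ E] {g : E → ℝ} (hg : ContDiff ℝ 2 g) (hmax : IsLocalMax g 0) (v : E) :
    0 ≤ fderiv ℝ (fderiv ℝ fun v => -g v) 0 v v := by
  have hT := hg.neg.sub_sub_fderiv_fderiv_isLittleO hmax.neg.fderiv_eq_zero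
  set B := fderiv ℝ (fderiv ℝ fun v => -g v) 0
  have hlim : Tendsto (fun t : ℝ => t • v) (𝓝[>] 0) (𝓝 0) := by
    have : Tendsto (fun t : ℝ => t • v) (𝓝 0) (𝓝 ((0 : ℝ) • v)) := tendsto_id.smul_const v
    rw [zero_smul] at this
    exact this.mono_left nhdsWithin_le_nhds
  by_contra! hneg
  -- Maximality forces a remainder of at least `-t ^ 2 * B v v` at `t • v`; this `ε` allows less
  -- than half of that.
  have hε : 0 < -(B v v) / (2 * (‖v‖ ^ 2 + 1)) := div_pos (neg_pos.2 hneg) (by positivity)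
  obtain ⟨t, ⟨hT', hm'⟩, ht⟩ :=
    (((hlim.eventually (hT.def hε)).and (hlim.eventually hmax)).and self_mem_nhdsWithin).exists
  have ht0 : (0 : ℝ) < t := ht
  rw [map_smul, map_smul, smul_apply, norm_pow, norm_norm, norm_smul,
    Real.norm_eq_abs, Real.norm_eq_abs, abs_of_pos ht0, div_mul_eq_mul_div,
    le_div_iff₀ (by positivity)] at hT'
  simp only [smul_eq_mul] at hT'
  have h1 := le_abs_self (2 * (-g (t • v) - -g 0) - t * (t * B v v))
  have h2 : -(t * (t * B v v)) ≤ |2 * (-g (t • v) - -g 0) - t * (t * B v v)| := by linarith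
  have h3 := (mul_le_mul_of_nonneg_right h2 (by positivity : 0 ≤ 2 * (‖v‖ ^ 2 + 1))).trans hT'
  have h4 : 0 < t ^ 2 * -(B v v) := mul_pos (by positivity) (neg_pos.2 hneg)
  nlinarith [mul_nonneg h4.le (sq_nonneg ‖v‖)]

open Matrix in
theorem norm_transpose_mulVec_sq {d : ℕ} (G : Matrix (Fin d) (Fin d) ℝ)
    (v : EuclideanSpace ℝ (Fin d)) :
    ‖WithLp.toLp 2 (Gᵀ *ᵥ v.ofLp)‖ ^ 2 = v.ofLp ⬝ᵥ (G * Gᵀ) *ᵥ v.ofLp := by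
  rw [EuclideanSpace.norm_sq_eq, ← mulVec_mulVec, dotProduct_mulVec, ← mulVec_transpose]
  simp [dotProduct, pow_two]

theorem Matrix.mul_diagonal_sqrt_mul_transpose {d : ℕ} {V H : Matrix (Fin d) (Fin d) ℝ}
    {ev : Fin d → ℝ} (hV : V ∈ Matrix.orthogonalGroup (Fin d) ℝ)
    (hH : V * Matrix.diagonal ev * V.transpose = H) (hpos : ∀ w, 0 ≤ w ⬝ᵥ H.mulVec w) :
    (V * Matrix.diagonal fun i => Real.sqrt (ev i)) *
      (V * Matrix.diagonal fun i => Real.sqrt (ev i)).transpose = H := by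
  have hVV : V.transpose * V = 1 := by
    simpa [Matrix.star_eq_conjTranspose] using (Matrix.mem_orthogonalGroup_iff' (Fin d) ℝ).1 hV
  -- Needed because `Real.sqrt` is `0` on negative numbers; the form is tested on the `i`-th column
  -- of `V`.
  have hev : ∀ i, 0 ≤ ev i := fun i => by
    have h := hpos (V.mulVec (Pi.single i 1))
    rw [← hH, Matrix.mulVec_mulVec, Matrix.mul_assoc, hVV, Matrix.mul_one,
      ← Matrix.mulVec_mulVec, Matrix.dotProduct_mulVec, ← Matrix.mulVec_transpose,
      Matrix.mulVec_mulVec, hVV] at h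
    simpa using h
  rw [Matrix.transpose_mul, Matrix.diagonal_transpose, ← hH, ← Matrix.mul_assoc,
    Matrix.mul_assoc V, Matrix.diagonal_mul_diagonal]
  simp only [Real.mul_self_sqrt (hev _)]

/-- A one-sided derivative suffices because `‖v‖ ^ 2` approaches `0` from within `[0, ∞)`. -/
theorem HasDerivWithinAt.norm_sq_sub_isLittleO {E : Type*} [NormedAddCommGroup E]
    {h : ℝ → ℝ} {h' : ℝ} (hh : HasDerivWithinAt h h' (Set.Ici 0) 0) :
    (fun v : E => h (‖v‖ ^ 2) - h 0 - ‖v‖ ^ 2 * h') =o[𝓝 0] fun v => ‖v‖ ^ 2 := by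
  have hlim : Tendsto (fun v : E => ‖v‖ ^ 2) (𝓝 0) (𝓝[Set.Ici 0] 0) := by
    refine tendsto_nhdsWithin_iff.2 ⟨?_, Eventually.of_forall fun v => sq_nonneg ‖v‖⟩
    exact (by fun_prop : Continuous fun v : E => ‖v‖ ^ 2).tendsto' 0 0 (by simp)
  have := hh.isLittleO.comp_tendsto hlim
  simpa [Function.comp_def] using this

/-! ### Translation-invariant kernels and the main result -/

/-- Geodesic distances in the image of a compact convex set under the feature map of a translation
invariant kernel `g (x - y)` which separates points. -/
theorem geodesicDist_mercerMap_image {E F : Type*} [NormedAddCommGroup E] [NormedSpace ℝ E]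
    [FiniteDimensional ℝ E] [MeasureSpace E] [NormedAddCommGroup F] [NormedSpace ℝ F]
    {Z S : Set E} (hZc : IsCompact Z) (hZ : Convex ℝ Z) (hZS : Z ⊆ S) {f : E → E → ℝ} {lam : ℕ → ℝ}
    {u : ℕ → E → ℝ} (hM : IsMercerExpansion S f lam u)
    (hsep : ∀ x ∈ Z, ∀ y ∈ Z, x ≠ y → ∃ a ∈ Z, f x a ≠ f y a) {g : E → ℝ}
    (hfg : ∀ x ∈ S, ∀ y ∈ S, f x y = g (x - y)) {L : E →L[ℝ] F}
    (hL : (fun v => 2 * (g 0 - g v) - ‖L v‖ ^ 2) =o[𝓝 0] fun v => ‖v‖ ^ 2)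
    {x y : E} (hx : x ∈ Z) (hy : y ∈ Z) :
    geodesicDist (mercerMap hM '' {z | z.1 ∈ Z}) (mercerMap hM ⟨x, hZS hx⟩)
      (mercerMap hM ⟨y, hZS hy⟩) = ENNReal.ofReal ‖L (x - y)‖ := by
  let φ : Z → lp (fun _ : ℕ => ℝ) 2 := fun z => mercerMap hM ⟨z, hZS z.2⟩
  have hrange : mercerMap hM '' {z | z.1 ∈ Z} = Set.range φ := by
    ext p
    constructor
    · rintro ⟨z, hz, rfl⟩
      exact ⟨⟨z, hz⟩, rfl⟩
    · rintro ⟨z, rfl⟩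
      exact ⟨⟨z, hZS z.2⟩, z.2, rfl⟩
  have hinj : Function.Injective φ := fun a b hab => by
    by_contra hne
    obtain ⟨c, hc, hfc⟩ := hsep a a.2 b b.2 fun h => hne (Subtype.ext h)
    apply hfc
    rw [← inner_mercerMap hM ⟨a, hZS a.2⟩ ⟨c, hZS hc⟩, ← inner_mercerMap hM ⟨b, hZS b.2⟩ ⟨c, hZS hc⟩]
    exact congrArg (inner ℝ · _) hab
  have hdist : ∀ a b : Z, dist (φ a) (φ b) ^ 2 = 2 * (g 0 - g (a - b)) := fun a b => by
    rw [dist_mercerMap_sq, hfg a (hZS a.2) a (hZS a.2), hfg a (hZS a.2) b (hZS b.2),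
      hfg b (hZS b.2) b (hZS b.2), sub_self, sub_self]
    ring
  rw [hrange]
  exact geodesicDist_range_eq (k := fun v => 2 * (g 0 - g v)) hZc hZ hinj hdist hL ⟨x, hx⟩ ⟨y, hy⟩

theorem proposition2 (d : ℕ) (hd : 1 ≤ d)
    -- the latent domain and a closed ball, centred at the origin, which contains it
    (Z : Set (EuclideanSpace ℝ (Fin d))) (hZc : IsCompact Z) (hZconv : Convex ℝ Z)
    (R : ℝ) (hR : 0 < R) (hZR : Z ⊆ Metric.closedBall 0 R)
    -- the kernel, with any of its Mercer expansions on the ball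
    (f : EuclideanSpace ℝ (Fin d) → EuclideanSpace ℝ (Fin d) → ℝ)
    (hf : IsNonnegDefKernelOn (Metric.closedBall 0 R) f)
    (lam : ℕ → ℝ) (u : ℕ → EuclideanSpace ℝ (Fin d) → ℝ)
    (hM : IsMercerExpansion (Metric.closedBall 0 R) f lam u)
    -- the kernel separates points
    (hsep : ∀ x ∈ Z, ∀ y ∈ Z, x ≠ y → ∃ a ∈ Z, f x a ≠ f y a)
    -- translation invariance
    (g : EuclideanSpace ℝ (Fin d) → ℝ) (hg : ContDiff ℝ 2 g) (hmax : IsLocalMax g 0)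
    (hfg : ∀ x ∈ Metric.closedBall 0 R, ∀ y ∈ Metric.closedBall 0 R, f x y = g (x - y)) :
    -- an eigendecomposition of the Hessian of `-g` at the origin yields `G = V Λ^{1/2}`
    (∀ (V : Matrix (Fin d) (Fin d) ℝ) (ev : Fin d → ℝ),
      V ∈ Matrix.orthogonalGroup (Fin d) ℝ →
      V * Matrix.diagonal ev * V.transpose = hessianMatrix (fun v => -g v) 0 →
      (V * Matrix.diagonal (fun i => Real.sqrt (ev i))) *
          (V * Matrix.diagonal (fun i => Real.sqrt (ev i))).transpose =
        hessianMatrix (fun v => -g v) 0) ∧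
    (∀ G : Matrix (Fin d) (Fin d) ℝ,
      G * G.transpose = hessianMatrix (fun v => -g v) 0 →
      ∀ (x y : EuclideanSpace ℝ (Fin d)) (hx : x ∈ Z) (hy : y ∈ Z),
        geodesicDist (mercerMap hM '' {z | z.1 ∈ Z})
            (mercerMap hM ⟨x, hZR hx⟩) (mercerMap hM ⟨y, hZR hy⟩) =
          ENNReal.ofReal ‖WithLp.toLp 2 (G.transpose.mulVec (x - y).ofLp)‖) ∧
    -- kernels which are functions of the squared distance
    (∀ (h : ℝ → ℝ) (h' : ℝ), HasDerivWithinAt h h' (Set.Ici 0) 0 → h' < 0 →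
      (∀ x ∈ Metric.closedBall 0 R, ∀ y ∈ Metric.closedBall 0 R, g (x - y) = h (‖x - y‖ ^ 2)) →
      ∃ c : ℝ, 0 < c ∧
        ∀ (x y : EuclideanSpace ℝ (Fin d)) (hx : x ∈ Z) (hy : y ∈ Z),
          geodesicDist (mercerMap hM '' {z | z.1 ∈ Z})
              (mercerMap hM ⟨x, hZR hx⟩) (mercerMap hM ⟨y, hZR hy⟩) =
            ENNReal.ofReal c * geodesicDist Z x y ∧
          geodesicDist Z x y = ENNReal.ofReal ‖x - y‖) := by
  have hquad : ∀ v : EuclideanSpace ℝ (Fin d), fderiv ℝ (fderiv ℝ fun v => -g v) 0 v v =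
      v.ofLp ⬝ᵥ (hessianMatrix (fun v => -g v) 0).mulVec v.ofLp := fun v =>
    fderiv_fderiv_apply_eq_dotProduct _ _ _ _
  refine ⟨fun V ev hV hH => ?_, fun G hG x y hx hy => ?_, fun h h' hh hneg hgh => ?_⟩
  · refine Matrix.mul_diagonal_sqrt_mul_transpose hV hH fun w => ?_
    exact (hmax.fderiv_fderiv_neg_nonneg hg (WithLp.toLp 2 w)).trans_eq (hquad _)
  · let L := (Matrix.toEuclideanLin G.transpose).toContinuousLinearMap
    have hL : ∀ v, L v = WithLp.toLp 2 (G.transpose.mulVec v.ofLp) := fun v => rfl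
    rw [← hL]
    refine geodesicDist_mercerMap_image hZc hZconv hZR hM hsep hfg ?_ hx hy
    refine (hg.neg.sub_sub_fderiv_fderiv_isLittleO hmax.neg.fderiv_eq_zero).congr_left fun v => ?_
    rw [hL, norm_transpose_mulVec_sq, hG, hquad]
    ring
  · have hc : 0 < -2 * h' := by linarith
    -- The constant comes from `2 * (g 0 - g v) = -2 * h' * ‖v‖ ^ 2 + o(‖v‖ ^ 2)`.
    refine ⟨Real.sqrt (-2 * h'), Real.sqrt_pos.2 hc, fun x y hx hy => ?_⟩
    have hZdist := geodesicDist_of_convex hZconv hx hy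
    refine ⟨?_, hZdist⟩
    let L : EuclideanSpace ℝ (Fin d) →L[ℝ] EuclideanSpace ℝ (Fin d) :=
      Real.sqrt (-2 * h') • ContinuousLinearMap.id ℝ _
    have hL : ∀ v, ‖L v‖ = Real.sqrt (-2 * h') * ‖v‖ := fun v => by
      simp [L, norm_smul, abs_of_nonneg (Real.sqrt_nonneg _)]
    rw [hZdist, ← ENNReal.ofReal_mul (Real.sqrt_nonneg _), ← hL]
    refine geodesicDist_mercerMap_image hZc hZconv hZR hM hsep hfg ?_ hx hy
    refine ((hh.norm_sq_sub_isLittleO.const_mul_left (-2)).congr' ?_ EventuallyEq.rfl)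
    have hg0 := hgh 0 (by simp [hR.le]) 0 (by simp [hR.le])
    filter_upwards [Metric.closedBall_mem_nhds 0 hR] with v hv
    have hgv := hgh v hv 0 (by simp [hR.le])
    rw [sub_zero] at hgv hg0
    rw [hL, mul_pow, Real.sq_sqrt hc.le, hgv, hg0]
    simp
    ring
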